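/- Let $X$ and $Y$ be second countable compact Hausdorff spaces with Borel $\sigma$-algebras $\mathfrak A_X$ and $\mathfrak A_Y$, and let $H$ be a complex Hilbert space. A quantum probability measure on a measurable space $(Z,\mathfrak A)$ with values in $\mathcal B(H)$ is a map $E:\mathfrak A\to\mathcal B(H)$ such that $E(\alpha)\ge 0$ for all $\alpha\in\mathfrak A$, $E(Z)=I_H$, and $E\big(\bigcup_{i=1}^\infty\alpha_i\big)=\sum_{i=1}^\infty E(\alpha_i)$ in the weak* topology of $\mathcal B(H)$ (as the dual of the trace class operators) for every sequence $(\alpha_i)_{i\in\mathbb N}$ of pairwise disjoint sets in $\mathfrak A$. It is called a spectral measure if $E(\alpha)$ is an orthogonal projection for every $\alpha\in\mathfrak A$. Let $E:\mathfrak A_X\to\mathcal B(H)$ and $F:\mathfrak A_Y\to\mathcal B(H)$ be quantum probability measures with commuting ranges, that is, $E(\delta)F(\theta)=F(\theta)E(\delta)$ for all $\delta\in\mathfrak A_X$ and $\theta\in\mathfrak A_Y$. Then there exists a unique quantum probability measure $E\cdot F:\mathfrak A_X\otimes\mathfrak A_Y\to\mathcal B(H)$ on the product $\sigma$-algebra such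 that $$(E\cdot F)(\delta\times\theta)=E(\delta)F(\theta),\qquad \delta\in\mathfrak A_X,\ \theta\in\mathfrak A_Y.$$ Moreover, if $E$ and $F$ are spectral measures, then $E\cdot F$ is a spectral measure. -/

import Mathlib

/-- The weak* topology of `B(H)`, that is, of the dual of the trace class operators on `H`.

The trace class operators are exactly the norm convergent sums `∑ₙ ⟪ηₙ, ·⟫ ξₙ` over pairs of
square-summable sequences `ξ`, `η` in `H`, and such an operator acts on `B(H)` by
`A ↦ ∑ₙ ⟪ηₙ, A ξₙ⟫`.
The weak* topology is the coarsest one making all these functionals continuous. -/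
@[reducible] noncomputable def weakStarTopology (H : Type*) [NormedAddCommGroup H] [InnerProductSpace ℂ H] :
    TopologicalSpace (H →L[ℂ] H) :=
  TopologicalSpace.induced
    (fun (A : H →L[ℂ] H)
      (p : {p : (ℕ → H) × (ℕ → H) //
        (Summable fun n => ‖p.1 n‖ ^ 2) ∧ (Summable fun n => ‖p.2 n‖ ^ 2)}) =>
      ∑' n, inner ℂ (p.1.2 n) (A (p.1.1 n)))
    Pi.topologicalSpace

/-- A quantum probability measure on a measurable space `X` with values in `B(H)`: a map from the
measurable sets to the positive operators, with value `1` at the whole space, and countably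
additive with respect to the weak* topology. -/
structure QuantumProbabilityMeasure (X : Type*) [MeasurableSpace X]
    (H : Type*) [NormedAddCommGroup H] [InnerProductSpace ℂ H] where
  toFun : {s : Set X // MeasurableSet s} → (H →L[ℂ] H)
  isPositive : ∀ s, (toFun s).IsPositive
  map_univ : toFun ⟨Set.univ, MeasurableSet.univ⟩ = 1
  hasSum_iUnion : ∀ s : ℕ → {s : Set X // MeasurableSet s},
    (∀ i j, i ≠ j → Disjoint (s i : Set X) (s j : Set X)) →
      @HasSum (H →L[ℂ] H) ℕ _ (weakStarTopology H) (fun i => toFun (s i))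
        (toFun ⟨⋃ i, (s i : Set X), MeasurableSet.iUnion fun i => (s i).2⟩)
        (SummationFilter.unconditional ℕ)

namespace QuantumProbabilityMeasure

variable {X Y H : Type*} [MeasurableSpace X] [MeasurableSpace Y]
  [NormedAddCommGroup H] [InnerProductSpace ℂ H]

/-- A spectral measure: all values are (orthogonal) projections. -/
def IsSpectral [CompleteSpace H] (E : QuantumProbabilityMeasure X H) : Prop :=
  ∀ s, IsStarProjection (E.toFun s)

/-- `E` and `F` have commuting ranges. -/
def CommutingRanges (E : QuantumProbabilityMeasure X H) (F : QuantumProbabilityMeasure Y H) :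
    Prop :=
  ∀ s t, Commute (E.toFun s) (F.toFun t)

/-- `G`, defined on the product σ-algebra, satisfies `G (δ × θ) = E δ F θ` on all measurable
rectangles. -/
def IsProduct (E : QuantumProbabilityMeasure X H) (F : QuantumProbabilityMeasure Y H)
    (G : QuantumProbabilityMeasure (X × Y) H) : Prop :=
  ∀ (δ : {s : Set X // MeasurableSet s}) (θ : {t : Set Y // MeasurableSet t}),
    G.toFun ⟨(δ : Set X) ×ˢ (θ : Set Y), δ.2.prod θ.2⟩ = E.toFun δ * F.toFun θ

end QuantumProbabilityMeasure

/-! Everything is read off the quadratic forms. Commuting positive operators have a positive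
product, so for fixed `x` the number `⟪E(A) F(B) x, x⟫` is nonnegative and is a finite measure in
each of `A` and `B` separately: a bimeasure. A bimeasure on an arbitrary measurable space need not
extend to the product. Here it does, because finite Borel measures on compact metrizable spaces are
regular: compactness makes the content on rectangles σ-subadditive
(`isSigmaSubadditive_bimeasureContent`), and Carathéodory extension gives a measure `m x`.

It remains to see that `m x s` is the quadratic form at `x` of one positive operator for every
measurable `s`. This holds on rectangles and passes to complements and, by strong convergence of
bounded monotone sequences, to disjoint unions (`exists_isPositive_of_measure_eq`). Countable
additivity of the forms becomes weak convergence by polarization, then weak* convergence by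
dominated convergence. Uniqueness is the π-system theorem for the scalar measures, and idempotence
spreads from rectangles by another π-λ induction. -/

section

open MeasureTheory Set Filter Topology ComplexOrder

/-! ### Extension of bimeasures to measures -/

/-- The measurable rectangles of `X × Y`. -/
def measurableRectangles (X Y : Type*) [MeasurableSpace X] [MeasurableSpace Y] :
    Set (Set (X × Y)) :=
  image2 (· ×ˢ ·) {s | MeasurableSet s} {t | MeasurableSet t}

theorem prod_mem_measurableRectangles {X Y : Type*} [MeasurableSpace X] [MeasurableSpace Y]
    {A : Set X} {B : Set Y} (hA : MeasurableSet A) (hB : MeasurableSet B) :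
    A ×ˢ B ∈ measurableRectangles X Y :=
  ⟨A, hA, B, hB, rfl⟩

theorem isSetSemiring_measurableRectangles (X Y : Type*) [MeasurableSpace X]
    [MeasurableSpace Y] : IsSetSemiring (measurableRectangles X Y) where
  empty_mem := ⟨∅, .empty, ∅, .empty, by simp⟩
  inter_mem := by
    rintro _ ⟨A, hA, B, hB, rfl⟩ _ ⟨A', hA', B', hB', rfl⟩
    exact ⟨A ∩ A', hA.inter hA', B ∩ B', hB.inter hB', prod_inter_prod.symm⟩
  sdiff_eq_sUnion' := by
    classical
    rintro _ ⟨A, hA, B, hB, rfl⟩ _ ⟨A', hA', B', hB', rfl⟩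
    refine ⟨{(A \ A') ×ˢ B, (A ∩ A') ×ˢ (B \ B')}, ?_, ?_, ?_⟩
    · simp only [Finset.coe_insert, Finset.coe_singleton, insert_subset_iff, singleton_subset_iff]
      exact ⟨prod_mem_measurableRectangles (hA.diff hA') hB,
        prod_mem_measurableRectangles (hA.inter hA') (hB.diff hB')⟩
    · rw [Finset.coe_insert, Finset.coe_singleton]
      refine pairwise_pair_of_symm.2 fun _ ↦ ?_
      exact Disjoint.set_prod_left (disjoint_sdiff_left.mono_right inter_subset_right) _ _
    · ext ⟨x, y⟩
      simp
      tauto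

/-- Finite additivity of a bimeasure on measurable rectangles. -/
theorem sum_bimeasure_eq {X Y ι : Type*} [MeasurableSpace X] [MeasurableSpace Y]
    (μ : Set Y → Measure X) (ν : Set X → Measure Y)
    (h : ∀ A B, MeasurableSet A → MeasurableSet B → μ B A = ν A B)
    (I : Finset ι) (A : ι → Set X) (B : ι → Set Y)
    (hA : ∀ i ∈ I, MeasurableSet (A i)) (hB : ∀ i ∈ I, MeasurableSet (B i))
    (hd : (I : Set ι).PairwiseDisjoint fun i ↦ A i ×ˢ B i)
    {A₀ : Set X} {B₀ : Set Y} (hA₀ : MeasurableSet A₀) (hB₀ : MeasurableSet B₀)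
    (hU : A₀ ×ˢ B₀ = ⋃ i ∈ I, A i ×ˢ B i) :
    μ B₀ A₀ = ∑ i ∈ I, μ (B i) (A i) := by
  classical
  have hν0 : ∀ B, MeasurableSet B → ν ∅ B = 0 := fun B hB ↦ by simp [← h ∅ B .empty hB]
  -- The fibres of `g` are the atoms cut out by the `A i`. Over the atom of `S`, every section of
  -- `A₀ ×ˢ B₀` is the disjoint union of the `B i` with `i ∈ S`, so the claim reduces to additivity
  -- of `ν (g ⁻¹' {S})`.
  let g : X → Finset ι := fun x ↦ I.filter fun i ↦ x ∈ A i
  have hg : ∀ S, MeasurableSet (g ⁻¹' {S}) := by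
    intro S
    by_cases hS : S ⊆ I
    · have : g ⁻¹' {S} = ⋂ i ∈ I, {x | x ∈ A i ↔ i ∈ S} := by
        ext x
        simp only [mem_preimage, mem_singleton_iff, Finset.ext_iff, g, Finset.mem_filter,
          mem_iInter, mem_ofPred_eq]
        refine forall_congr' fun i ↦ ?_
        have := @hS i
        tauto
      rw [this]
      refine Finset.measurableSet_biInter _ fun i hi ↦ ?_
      by_cases hiS : i ∈ S
      · simpa [hiS] using hA i hi
      · simp only [hiS, iff_false]
        exact (hA i hi).compl
    · convert! MeasurableSet.empty
      ext x
      simp only [mem_preimage, mem_singleton_iff, mem_empty_iff_false, iff_false]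
      rintro rfl
      exact hS (Finset.filter_subset _ _)
  have key : ∀ A' B', MeasurableSet A' → MeasurableSet B' →
      μ B' A' = ∑ S ∈ I.powerset, ν (g ⁻¹' {S} ∩ A') B' := by
    intro A' B' hA' hB'
    have h1 := sum_measure_preimage_singleton (μ := (μ B').restrict A') I.powerset (f := g)
      fun S _ ↦ hg S
    have h2 : g ⁻¹' (I.powerset : Set (Finset ι)) = univ := by
      ext x
      simp only [g, mem_preimage, Finset.mem_coe, Finset.mem_powerset, mem_univ, iff_true]
      exact Finset.filter_subset _ _
    rw [h2, Measure.restrict_apply_univ] at h1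
    rw [← h1]
    refine Finset.sum_congr rfl fun S _ ↦ ?_
    rw [Measure.restrict_apply (hg S), h _ _ ((hg S).inter hA') hB']
  rw [key _ _ hA₀ hB₀, Finset.sum_congr rfl fun i hi ↦ key _ _ (hA i hi) (hB i hi),
    Finset.sum_comm]
  refine Finset.sum_congr rfl fun S hS ↦ ?_
  rw [Finset.mem_powerset] at hS
  have hmem : ∀ x ∈ g ⁻¹' {S}, ∀ i ∈ I, (x ∈ A i ↔ i ∈ S) := by
    rintro x rfl i hi
    simp [g, hi]
  have hsec : ∀ x ∈ g ⁻¹' {S}, (⋃ i ∈ S, B i) = {y | x ∈ A₀ ∧ y ∈ B₀} := by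
    intro x hx
    ext y
    have : (x, y) ∈ A₀ ×ˢ B₀ ↔ (x, y) ∈ ⋃ i ∈ I, A i ×ˢ B i := by rw [hU]
    simp only [mem_prod, mem_iUnion, exists_prop] at this
    simp only [mem_iUnion, exists_prop, mem_ofPred_eq, this]
    constructor
    · rintro ⟨i, hi, hy⟩
      exact ⟨i, hS hi, (hmem x hx i (hS hi)).2 hi, hy⟩
    · rintro ⟨i, hi, hxi, hy⟩
      exact ⟨i, (hmem x hx i hi).1 hxi, hy⟩
  rcases (g ⁻¹' {S}).eq_empty_or_nonempty with he | ⟨x₀, hx₀⟩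
  · rw [he, empty_inter, hν0 _ hB₀]
    refine (Finset.sum_eq_zero fun i hi ↦ ?_).symm
    rw [empty_inter, hν0 _ (hB i hi)]
  have hsum : ∑ i ∈ I, ν (g ⁻¹' {S} ∩ A i) (B i) = ν (g ⁻¹' {S}) (⋃ i ∈ S, B i) := by
    rw [measure_biUnion_finset]
    · rw [← Finset.sum_subset hS]
      · refine Finset.sum_congr rfl fun i hi ↦ ?_
        rw [inter_eq_left.2 fun x hx ↦ (hmem x hx i (hS hi)).2 hi]
      · intro i hi hiS
        have : g ⁻¹' {S} ∩ A i = ∅ := by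
          ext x
          simp only [mem_inter_iff, mem_empty_iff_false, iff_false, not_and]
          exact fun hx hxi ↦ hiS ((hmem x hx i hi).1 hxi)
        rw [this, hν0 _ (hB i hi)]
    · intro i hi j hj hij
      refine Set.disjoint_left.2 fun y hyi hyj ↦ ?_
      have hij' : Disjoint (A i ×ˢ B i) (A j ×ˢ B j) := hd (hS hi) (hS hj) hij
      have hi' : (x₀, y) ∈ A i ×ˢ B i := ⟨(hmem x₀ hx₀ i (hS hi)).2 hi, hyi⟩
      exact Set.disjoint_left.1 hij' hi' ⟨(hmem x₀ hx₀ j (hS hj)).2 hj, hyj⟩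
    · exact fun i hi ↦ hB i (hS hi)
  rw [hsum]
  by_cases hsub : g ⁻¹' {S} ⊆ A₀
  · rw [inter_eq_left.2 hsub, hsec x₀ hx₀]
    simp [hsub hx₀]
  -- A point of the atom outside `A₀` has empty section, so the right side vanishes; the left side
  -- does too, since an atom that also meets `A₀` forces `B₀ = ∅`.
  obtain ⟨x₁, hx₁, hx₁A⟩ := not_subset.1 hsub
  have hUe : (⋃ i ∈ S, B i) = ∅ := by
    rw [hsec x₁ hx₁]; simp [hx₁A]
  rw [hUe, measure_empty]
  by_cases hne : (g ⁻¹' {S} ∩ A₀).Nonempty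
  · obtain ⟨x₂, hx₂, hx₂A⟩ := hne
    have hB0 : B₀ = ∅ := by
      have := hsec x₂ hx₂
      rw [hUe] at this
      simpa [hx₂A] using this.symm
    simp [hB0]
  · rw [not_nonempty_iff_eq_empty.1 hne, hν0 _ hB₀]

/-- The content on measurable rectangles associated with a bimeasure. -/
noncomputable def bimeasureContent {X Y : Type*} [MeasurableSpace X] [MeasurableSpace Y]
    (μ : Set Y → Measure X) (ν : Set X → Measure Y)
    (h : ∀ A B, MeasurableSet A → MeasurableSet B → μ B A = ν A B) :
    AddContent ENNReal (measurableRectangles X Y) where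
  -- The projections recover the sides of a nonempty rectangle; if one side is empty, both
  -- projections are empty and the value is `0`.
  toFun R := μ (Prod.snd '' R) (Prod.fst '' R)
  empty' := by simp
  sUnion' I hI hd hmem := by
    have hfst : ∀ R ∈ measurableRectangles X Y, MeasurableSet (Prod.fst '' R) := by
      rintro _ ⟨A, hA, B, hB, rfl⟩
      rcases B.eq_empty_or_nonempty with rfl | hB'
      · simp
      · simpa [fst_image_prod _ hB'] using hA
    have hsnd : ∀ R ∈ measurableRectangles X Y, MeasurableSet (Prod.snd '' R) := by
      rintro _ ⟨A, hA, B, hB, rfl⟩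
      rcases A.eq_empty_or_nonempty with rfl | hA'
      · simp
      · simpa [snd_image_prod hA'] using hB
    have hprod : ∀ R ∈ measurableRectangles X Y, (Prod.fst '' R) ×ˢ (Prod.snd '' R) = R := by
      rintro _ ⟨A, hA, B, hB, rfl⟩
      rcases A.eq_empty_or_nonempty with rfl | hA'
      · simp
      rcases B.eq_empty_or_nonempty with rfl | hB'
      · simp
      simp [fst_image_prod _ hB', snd_image_prod hA']
    refine sum_bimeasure_eq μ ν h I (fun R ↦ Prod.fst '' R) (fun R ↦ Prod.snd '' R)
      (fun R hR ↦ hfst R (hI hR)) (fun R hR ↦ hsnd R (hI hR)) ?_ (hfst _ hmem) (hsnd _ hmem) ?_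
    · intro R hR R' hR' hne
      simpa only [Function.onFun, hprod R (hI hR), hprod R' (hI hR'), id] using hd hR hR' hne
    · rw [hprod _ hmem, sUnion_eq_biUnion]
      exact iUnion₂_congr fun R hR ↦ (hprod R (hI hR)).symm

theorem bimeasureContent_prod {X Y : Type*} [MeasurableSpace X] [MeasurableSpace Y]
    (μ : Set Y → Measure X) (ν : Set X → Measure Y)
    (h : ∀ A B, MeasurableSet A → MeasurableSet B → μ B A = ν A B)
    {A : Set X} {B : Set Y} (hA : MeasurableSet A) (hB : MeasurableSet B) :
    bimeasureContent μ ν h (A ×ˢ B) = μ B A := by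
  change μ (Prod.snd '' _) (Prod.fst '' _) = _
  rcases A.eq_empty_or_nonempty with rfl | hA'
  · simp
  rcases B.eq_empty_or_nonempty with rfl | hB'
  · simp [h A ∅ hA .empty]
  rw [fst_image_prod _ hB', snd_image_prod hA']

/-- Changing one side at a time costs at most the marginal measure of the difference. No inclusion
is assumed, so this serves both for shrinking to compact sets and for enlarging to open ones. -/
theorem bimeasure_le_add {X Y : Type*} [MeasurableSpace X] [MeasurableSpace Y]
    (μ : Set Y → Measure X) (ν : Set X → Measure Y)
    (h : ∀ A B, MeasurableSet A → MeasurableSet B → μ B A = ν A B)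
    {K A : Set X} {L B : Set Y} (hK : MeasurableSet K) (hA : MeasurableSet A)
    (hL : MeasurableSet L) (hB : MeasurableSet B) :
    μ B A ≤ μ L K + (μ univ (A \ K) + ν univ (B \ L)) := by
  have hmono : ∀ {B B' : Set Y} {A : Set X}, MeasurableSet B → MeasurableSet B' →
      MeasurableSet A → B ⊆ B' → μ B A ≤ μ B' A := by
    intro B B' A hB hB' hA hBB'
    rw [h A B hA hB, h A B' hA hB']
    exact measure_mono hBB'
  calc μ B A ≤ μ B K + μ B (A \ K) := by
        refine (measure_mono ?_).trans (measure_union_le K (A \ K))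
        simp
    _ ≤ (μ L K + ν univ (B \ L)) + μ univ (A \ K) := by
        gcongr ?_ + ?_
        · calc μ B K = ν K B := h K B hK hB
            _ ≤ ν K L + ν K (B \ L) := by
              refine (measure_mono ?_).trans (measure_union_le L (B \ L))
              simp
            _ ≤ μ L K + ν univ (B \ L) := by
              rw [← h K L hK hL, ← h K _ hK (hB.diff hL), ← h _ _ .univ (hB.diff hL)]
              gcongr
              exact subset_univ _
        · exact hmono hB .univ (hA.diff hK) (subset_univ _)
    _ = _ := by ring

/-- Shrink the covered rectangle to a compact one and enlarge the covering ones to open ones, at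
small cost in the marginals. A finite subcover then exists, and finite subadditivity of the content
suffices. -/
theorem isSigmaSubadditive_bimeasureContent
    {X : Type*} [TopologicalSpace X] [CompactSpace X] [T2Space X] [SecondCountableTopology X]
    [MeasurableSpace X] [BorelSpace X]
    {Y : Type*} [TopologicalSpace Y] [CompactSpace Y] [T2Space Y] [SecondCountableTopology Y]
    [MeasurableSpace Y] [BorelSpace Y]
    (μ : Set Y → Measure X) (ν : Set X → Measure Y)
    [∀ B, IsFiniteMeasure (μ B)] [∀ A, IsFiniteMeasure (ν A)]
    (h : ∀ A B, MeasurableSet A → MeasurableSet B → μ B A = ν A B) :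
    (bimeasureContent μ ν h).IsSigmaSubadditive := by
  classical
  let _ := TopologicalSpace.metrizableSpaceMetric X
  let _ := TopologicalSpace.metrizableSpaceMetric Y
  have hC := isSetSemiring_measurableRectangles X Y
  intro f hf hfU
  choose A hA B hB hAB using hf
  obtain ⟨A₀, hA₀, B₀, hB₀, hU⟩ := hfU
  simp only [mem_ofPred_eq] at hA hB hA₀ hB₀
  refine ENNReal.le_of_forall_pos_le_add fun ε hε _ ↦ ?_
  -- One third each for `K`, for `L` and for all the open enlargements together; `ε' i` is halved
  -- between `U i` and `V i`.
  have hε3 : (ε : ENNReal) / 3 ≠ 0 := by simp [hε.ne']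
  obtain ⟨ε', hε', hε's⟩ := ENNReal.exists_pos_sum_of_countable' hε3 ℕ
  have hε'2 : ∀ i, ε' i / 2 ≠ 0 := fun i ↦ by simp [(hε' i).ne']
  obtain ⟨K, hKA, hK, hμK⟩ := hA₀.exists_isCompact_sdiff_lt (measure_ne_top (μ univ) _) hε3
  obtain ⟨L, hLB, hL, hνL⟩ := hB₀.exists_isCompact_sdiff_lt (measure_ne_top (ν univ) _) hε3
  choose U hAU hUo _ hμU using fun i ↦
    (hA i).exists_isOpen_sdiff_lt (measure_ne_top (μ univ) _) (hε'2 i)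
  choose V hBV hVo _ hνV using fun i ↦
    (hB i).exists_isOpen_sdiff_lt (measure_ne_top (ν univ) _) (hε'2 i)
  have hcov : K ×ˢ L ⊆ ⋃ i, U i ×ˢ V i := by
    refine (prod_mono hKA hLB).trans ?_
    change (fun A B ↦ A ×ˢ B) A₀ B₀ ⊆ _
    rw [hU]
    refine iUnion_mono fun i ↦ ?_
    rw [← hAB i]
    exact prod_mono (hAU i) (hBV i)
  obtain ⟨t, ht⟩ := (hK.prod hL).elim_finite_subcover _ (fun i ↦ (hUo i).prod (hVo i)) hcov
  have hfin : μ L K ≤ ∑ i ∈ t, μ (V i) (U i) := by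
    rw [← bimeasureContent_prod μ ν h hK.measurableSet hL.measurableSet]
    have := addContent_le_sum_of_subset_sUnion (m := bimeasureContent μ ν h) hC
      (J := t.image fun i ↦ U i ×ˢ V i) (t := K ×ˢ L) ?_ ?_ ?_
    · refine this.trans ((Finset.sum_image_le_of_nonneg fun _ _ ↦ zero_le).trans ?_)
      refine Finset.sum_le_sum fun i _ ↦ ?_
      rw [bimeasureContent_prod μ ν h (hUo i).measurableSet (hVo i).measurableSet]
    · intro R hR
      obtain ⟨i, -, rfl⟩ := Finset.mem_image.1 hR
      exact prod_mem_measurableRectangles (hUo i).measurableSet (hVo i).measurableSet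
    · exact prod_mem_measurableRectangles hK.measurableSet hL.measurableSet
    · simpa using ht
  have hfi : ∀ i, bimeasureContent μ ν h (f i) = μ (B i) (A i) := fun i ↦ by
    rw [← hAB i, bimeasureContent_prod μ ν h (hA i) (hB i)]
  rw [← hU]
  calc bimeasureContent μ ν h (A₀ ×ˢ B₀) = μ B₀ A₀ := bimeasureContent_prod μ ν h hA₀ hB₀
    _ ≤ μ L K + (μ univ (A₀ \ K) + ν univ (B₀ \ L)) :=
      bimeasure_le_add μ ν h hK.measurableSet hA₀ hL.measurableSet hB₀
    _ ≤ (∑ i ∈ t, μ (V i) (U i)) + (ε / 3 + ε / 3) := by gcongr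
    _ ≤ (∑' i, μ (V i) (U i)) + (ε / 3 + ε / 3) := by gcongr; exact ENNReal.sum_le_tsum t
    _ ≤ (∑' i, (bimeasureContent μ ν h (f i) + ε' i)) + (ε / 3 + ε / 3) := by
      gcongr with i
      rw [hfi]
      refine (bimeasure_le_add μ ν h (hA i) (hUo i).measurableSet (hB i)
        (hVo i).measurableSet).trans ?_
      gcongr
      calc _ ≤ ε' i / 2 + ε' i / 2 := add_le_add (hμU i).le (hνV i).le
        _ = ε' i := ENNReal.add_halves _
    _ ≤ ∑' i, bimeasureContent μ ν h (f i) + (ε / 3 + (ε / 3 + ε / 3)) := by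
      rw [ENNReal.tsum_add, add_assoc]
      gcongr
    _ = _ := by rw [← add_assoc (ε / 3 : ENNReal), ENNReal.add_thirds]

/-- A finite bimeasure on second countable compact Hausdorff spaces extends to a measure on the
product. -/
theorem exists_measure_prod_eq_bimeasure
    {X : Type*} [TopologicalSpace X] [CompactSpace X] [T2Space X] [SecondCountableTopology X]
    [MeasurableSpace X] [BorelSpace X]
    {Y : Type*} [TopologicalSpace Y] [CompactSpace Y] [T2Space Y] [SecondCountableTopology Y]
    [MeasurableSpace Y] [BorelSpace Y]
    (μ : Set Y → Measure X) (ν : Set X → Measure Y)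
    [∀ B, IsFiniteMeasure (μ B)] [∀ A, IsFiniteMeasure (ν A)]
    (h : ∀ A B, MeasurableSet A → MeasurableSet B → μ B A = ν A B) :
    ∃ m : Measure (X × Y), ∀ A B, MeasurableSet A → MeasurableSet B → m (A ×ˢ B) = μ B A := by
  have hgen : (inferInstance : MeasurableSpace (X × Y)) =
      MeasurableSpace.generateFrom (measurableRectangles X Y) := generateFrom_prod.symm
  refine ⟨(bimeasureContent μ ν h).measure (isSetSemiring_measurableRectangles X Y) hgen.le
    (isSigmaSubadditive_bimeasureContent μ ν h), fun A B hA hB ↦ ?_⟩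
  rw [AddContent.measure_eq _ _ hgen _ (prod_mem_measurableRectangles hA hB),
    bimeasureContent_prod μ ν h hA hB]

/-! ### Quadratic forms, weak* and strong convergence -/

section Operators

variable {H : Type*} [NormedAddCommGroup H] [InnerProductSpace ℂ H]

theorem ContinuousLinearMap.IsPositive.inner_map_self_eq_reApplyInnerSelf {T : H →L[ℂ] H}
    (hT : T.IsPositive) (x : H) : inner ℂ (T x) x = (T.reApplyInnerSelf x : ℂ) :=
  (((ContinuousLinearMap.isPositive_iff_complex T).1 hT x).1).symm

theorem ContinuousLinearMap.IsPositive.ext_reApplyInnerSelf {T S : H →L[ℂ] H}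
    (hT : T.IsPositive) (hS : S.IsPositive)
    (h : ∀ x, T.reApplyInnerSelf x = S.reApplyInnerSelf x) : T = S := by
  have : (T : H →ₗ[ℂ] H) = S := (ext_inner_map _ _).1 fun x ↦ by
    have h1 := hT.inner_map_self_eq_reApplyInnerSelf x
    have h2 := hS.inner_map_self_eq_reApplyInnerSelf x
    rw [h x, ← h2] at h1
    exact h1
  exact ContinuousLinearMap.coe_injective this

theorem ContinuousLinearMap.reApplyInnerSelf_add (T S : H →L[ℂ] H) (x : H) :
    (T + S).reApplyInnerSelf x = T.reApplyInnerSelf x + S.reApplyInnerSelf x := by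
  simp [ContinuousLinearMap.reApplyInnerSelf_apply, inner_add_left]

theorem ContinuousLinearMap.reApplyInnerSelf_sub (T S : H →L[ℂ] H) (x : H) :
    (T - S).reApplyInnerSelf x = T.reApplyInnerSelf x - S.reApplyInnerSelf x := by
  simp [ContinuousLinearMap.reApplyInnerSelf_apply, inner_sub_left]

theorem ContinuousLinearMap.reApplyInnerSelf_sum {ι : Type*} (t : Finset ι)
    (T : ι → H →L[ℂ] H) (x : H) :
    (∑ i ∈ t, T i).reApplyInnerSelf x = ∑ i ∈ t, (T i).reApplyInnerSelf x := by
  simp [ContinuousLinearMap.reApplyInnerSelf_apply, sum_inner]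

theorem ContinuousLinearMap.reApplyInnerSelf_one (x : H) :
    (1 : H →L[ℂ] H).reApplyInnerSelf x = ‖x‖ ^ 2 := by
  simp [ContinuousLinearMap.reApplyInnerSelf_apply, ← inner_self_eq_norm_sq (𝕜 := ℂ)]

theorem ContinuousLinearMap.IsPositive.le_of_reApplyInnerSelf_le {T S : H →L[ℂ] H}
    (hT : T.IsPositive) (hS : S.IsPositive)
    (h : ∀ x, T.reApplyInnerSelf x ≤ S.reApplyInnerSelf x) : T ≤ S := by
  rw [ContinuousLinearMap.le_def]
  refine ⟨hS.isSymmetric.sub hT.isSymmetric, fun x ↦ ?_⟩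
  have := (S.reApplyInnerSelf_sub T x).ge.trans' (sub_nonneg.2 (h x))
  exact this

theorem ContinuousLinearMap.reApplyInnerSelf_mono {T S : H →L[ℂ] H} (h : T ≤ S) (x : H) :
    T.reApplyInnerSelf x ≤ S.reApplyInnerSelf x := by
  have := ((ContinuousLinearMap.le_def _ _).1 h).re_inner_nonneg_left x
  rw [← sub_nonneg, ← S.reApplyInnerSelf_sub]
  exact this

/-- Weak convergence of a series of positive operators follows from convergence of the
quadratic forms. -/
theorem hasSum_inner_of_hasSum_reApplyInnerSelf {ι : Type*} {T : ι → H →L[ℂ] H} {S : H →L[ℂ] H}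
    (hT : ∀ i, (T i).IsPositive) (hS : S.IsPositive)
    (h : ∀ x, HasSum (fun i ↦ (T i).reApplyInnerSelf x) (S.reApplyInnerSelf x)) (x y : H) :
    HasSum (fun i ↦ inner ℂ y (T i x)) (inner ℂ y (S x)) := by
  have hq : ∀ z, HasSum (fun i ↦ inner ℂ (T i z) z) (inner ℂ (S z) z) := fun z ↦ by
    simp only [fun i ↦ (hT i).inner_map_self_eq_reApplyInnerSelf z,
      hS.inner_map_self_eq_reApplyInnerSelf z]
    exact Complex.hasSum_ofReal.2 (h z)
  simp only [← (hT _).inner_left_eq_inner_right, ← hS.inner_left_eq_inner_right]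
  have key : ∀ R : H →L[ℂ] H, inner ℂ (R y) x = (inner ℂ (R (x + y)) (x + y) -
      inner ℂ (R (x - y)) (x - y) + Complex.I * inner ℂ (R (x + Complex.I • y)) (x + Complex.I • y)
      - Complex.I * inner ℂ (R (x - Complex.I • y)) (x - Complex.I • y)) / 4 :=
    fun R ↦ inner_map_polarization (R : H →ₗ[ℂ] H) x y
  simp only [key]
  exact ((((hq _).sub (hq _)).add ((hq _).mul_left _)).sub ((hq _).mul_left _)).div_const _

theorem continuous_weakStarTopology_inner (x y : H) :
    @Continuous _ _ (weakStarTopology H) _ fun A : H →L[ℂ] H ↦ (inner ℂ y (A x) : ℂ) := by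
  classical
  let _ := weakStarTopology H
  have hs : ∀ z : H, Summable fun n ↦ ‖(Pi.single 0 z : ℕ → H) n‖ ^ 2 := fun z ↦ by
    refine summable_of_ne_finset_zero (s := {0}) fun n hn ↦ ?_
    simp [Pi.single_eq_of_ne (Finset.notMem_singleton.1 hn)]
  let p : {p : (ℕ → H) × (ℕ → H) //
      (Summable fun n => ‖p.1 n‖ ^ 2) ∧ (Summable fun n => ‖p.2 n‖ ^ 2)} :=
    -- Sequences supported at index `0` encode a rank-one operator.
    ⟨(Pi.single 0 x, Pi.single 0 y), hs x, hs y⟩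
  let Φ : (H →L[ℂ] H) → {p : (ℕ → H) × (ℕ → H) //
      (Summable fun n => ‖p.1 n‖ ^ 2) ∧ (Summable fun n => ‖p.2 n‖ ^ 2)} → ℂ :=
    fun A p ↦ ∑' n, inner ℂ (p.1.2 n) (A (p.1.1 n))
  have hΦ : Continuous Φ := continuous_induced_dom
  have h : Continuous fun A ↦ Φ A p := (continuous_apply p).comp hΦ
  convert h with A
  simp only [Φ]
  rw [tsum_eq_single 0 fun n hn ↦ by simp [p, Pi.single_eq_of_ne hn]]
  simp [p]

/-- A bounded series of operators which converges weakly also converges in the weak* topology. -/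
theorem hasSum_weakStarTopology_of_hasSum_inner {T : ℕ → H →L[ℂ] H} {S : H →L[ℂ] H}
    (hb : ∀ t : Finset ℕ, ‖∑ i ∈ t, T i‖ ≤ 1)
    (h : ∀ x y, HasSum (fun i ↦ inner ℂ y (T i x)) (inner ℂ y (S x))) :
    @HasSum (H →L[ℂ] H) ℕ _ (weakStarTopology H) T S (SummationFilter.unconditional ℕ) := by
  unfold HasSum
  rw [nhds_induced, tendsto_comap_iff, tendsto_pi_nhds]
  rintro ⟨⟨ξ, η⟩, hξ, hη⟩
  refine tendsto_tsum_of_dominated_convergence (hξ.add hη) (fun n ↦ ?_)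
    (Eventually.of_forall fun t n ↦ ?_)
  · have := h (ξ n) (η n)
    simp only [HasSum, ← inner_sum] at this
    simpa only [sum_apply] using this
  · calc ‖(inner ℂ (η n) ((∑ i ∈ t, T i) (ξ n)) : ℂ)‖
        ≤ ‖η n‖ * ‖(∑ i ∈ t, T i) (ξ n)‖ := norm_inner_le_norm _ _
      _ ≤ ‖η n‖ * ‖ξ n‖ := by
        gcongr
        exact (ContinuousLinearMap.le_of_opNorm_le _ (hb t) _).trans_eq (one_mul _)
      _ ≤ ‖ξ n‖ ^ 2 + ‖η n‖ ^ 2 := by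
        nlinarith [sq_nonneg (‖ξ n‖ - ‖η n‖), sq_nonneg ‖ξ n‖, sq_nonneg ‖η n‖]

variable [CompleteSpace H]

/-- `0 ≤ P ≤ 1` gives `P ^ 2 ≤ P`. Applied to differences, this turns Cauchy quadratic forms into
strongly Cauchy operators. -/
theorem ContinuousLinearMap.IsPositive.norm_apply_sq_le {P : H →L[ℂ] H} (hP : P.IsPositive)
    (hP1 : P ≤ 1) (x : H) : ‖P x‖ ^ 2 ≤ P.reApplyInnerSelf x := by
  have h := CStarAlgebra.pow_antitone ((ContinuousLinearMap.nonneg_iff_isPositive P).2 hP) hP1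
    one_le_two
  have h' := ContinuousLinearMap.reApplyInnerSelf_mono h x
  simp only [pow_one] at h'
  refine le_trans (le_of_eq ?_) h'
  rw [ContinuousLinearMap.reApplyInnerSelf_apply, pow_two P, mul_apply_eq_comp,
    hP.inner_left_eq_inner_right, inner_self_eq_norm_sq]

/-- A monotone sequence of positive contractions converges strongly. -/
theorem exists_tendsto_apply_of_monotone {P : ℕ → H →L[ℂ] H} (hP : ∀ n, (P n).IsPositive)
    (hm : Monotone P) (h1 : ∀ n, P n ≤ 1) :
    ∃ T : H →L[ℂ] H, T.IsPositive ∧ ∀ x, Tendsto (fun n ↦ P n x) atTop (𝓝 (T x)) := by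
  have hc : ∀ x, ∃ y, Tendsto (fun n ↦ P n x) atTop (𝓝 y) := by
    intro x
    refine cauchySeq_tendsto_of_complete ?_
    have ha : CauchySeq fun n ↦ (P n).reApplyInnerSelf x := by
      refine (tendsto_atTop_ciSup
        (fun n m hnm ↦ ContinuousLinearMap.reApplyInnerSelf_mono (hm hnm) x) ?_).cauchySeq
      refine ⟨‖x‖ ^ 2, ?_⟩
      rintro _ ⟨n, rfl⟩
      exact (ContinuousLinearMap.reApplyInnerSelf_mono (h1 n) x).trans_eq
        (ContinuousLinearMap.reApplyInnerSelf_one x)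
    rw [Metric.cauchySeq_iff'] at ha ⊢
    intro ε hε
    obtain ⟨N, hN⟩ := ha (ε ^ 2) (by positivity)
    refine ⟨N, fun n hn ↦ ?_⟩
    have hd := hm hn
    have hle : P n - P N ≤ 1 :=
      (sub_le_self _ ((ContinuousLinearMap.nonneg_iff_isPositive _).2 (hP N))).trans (h1 n)
    have h2 := ((ContinuousLinearMap.le_def _ _).1 hd).norm_apply_sq_le hle x
    rw [ContinuousLinearMap.reApplyInnerSelf_sub] at h2
    have h3 := hN n hn
    rw [Real.dist_eq] at h3
    rw [dist_eq_norm]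
    exact lt_of_pow_lt_pow_left₀ 2 hε.le ((h2.trans (le_abs_self _)).trans_lt h3)
  choose f hf using hc
  refine ⟨continuousLinearMapOfTendsto P (tendsto_pi_nhds.2 hf), ?_, hf⟩
  rw [ContinuousLinearMap.isPositive_iff_complex]
  intro x
  have : 0 ≤ (inner ℂ (f x) x : ℂ) :=
    ge_of_tendsto' ((hf x).inner tendsto_const_nhds) fun n ↦ (hP n).inner_nonneg_left x
  rw [Complex.nonneg_iff] at this
  exact ⟨Complex.ext rfl this.2, this.1⟩

end Operators

/-! ### From scalar measures to operators -/

/-- A nonnegative countably additive real set function is a finite measure. -/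
theorem exists_measure_eq_ofReal {Z : Type*} [MeasurableSpace Z]
    (φ : {s : Set Z // MeasurableSet s} → ℝ) (hφ : ∀ s, 0 ≤ φ s)
    (hsum : ∀ s : ℕ → {s : Set Z // MeasurableSet s},
      (∀ i j, i ≠ j → Disjoint (s i : Set Z) (s j : Set Z)) →
        HasSum (fun i ↦ φ (s i)) (φ ⟨⋃ i, (s i : Set Z), .iUnion fun i ↦ (s i).2⟩)) :
    ∃ μ : Measure Z, IsFiniteMeasure μ ∧
      ∀ s : {s : Set Z // MeasurableSet s}, μ s = ENNReal.ofReal (φ s) := by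
  have h0 : φ ⟨∅, .empty⟩ = 0 := by
    -- A constant real sequence is summable only if it is zero.
    have := (hsum (fun _ ↦ ⟨∅, .empty⟩) fun _ _ _ ↦ disjoint_empty _).summable
    exact (summable_const_iff _).1 this
  let μ : Measure Z := Measure.ofMeasurable (fun s hs ↦ ENNReal.ofReal (φ ⟨s, hs⟩))
    (by rw [h0, ENNReal.ofReal_zero]) fun s hs hd ↦ by
      have h := hsum (fun i ↦ ⟨s i, hs i⟩) fun i j hij ↦ hd hij
      rw [← h.tsum_eq, ENNReal.ofReal_tsum_of_nonneg (fun _ ↦ hφ _) h.summable]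
  have hμ : ∀ s : {s : Set Z // MeasurableSet s}, μ s = ENNReal.ofReal (φ s) := fun s ↦
    Measure.ofMeasurable_apply _ s.2
  exact ⟨μ, ⟨by rw [hμ ⟨univ, .univ⟩]; exact ENNReal.ofReal_lt_top⟩, hμ⟩

/-- If a family of finite measures `m x` is given on a generating π-system by quadratic forms
of positive operators, then it is so on all measurable sets. -/
theorem exists_isPositive_of_measure_eq {Z H : Type*} [MeasurableSpace Z]
    [NormedAddCommGroup H] [InnerProductSpace ℂ H] [CompleteSpace H]
    {C : Set (Set Z)} (hC : ‹MeasurableSpace Z› = MeasurableSpace.generateFrom C)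
    (hpi : IsPiSystem C) (m : H → Measure Z) [∀ x, IsFiniteMeasure (m x)]
    (huniv : ∀ x, m x univ = ENNReal.ofReal (‖x‖ ^ 2))
    (h : ∀ s ∈ C, ∃ T : H →L[ℂ] H, T.IsPositive ∧
      ∀ x, m x s = ENNReal.ofReal (T.reApplyInnerSelf x))
    (s : Set Z) (hs : MeasurableSet s) :
    ∃ T : H →L[ℂ] H, T.IsPositive ∧ ∀ x, m x s = ENNReal.ofReal (T.reApplyInnerSelf x) := by
  have hone : (1 : H →L[ℂ] H).IsPositive := ContinuousLinearMap.isPositive_one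
  -- The total mass `‖x‖ ^ 2` forces `T ≤ 1`: this makes `1 - T` positive for complements and bounds
  -- the partial sums for unions.
  have hle : ∀ s, ∀ T : H →L[ℂ] H, T.IsPositive →
      (∀ x, m x s = ENNReal.ofReal (T.reApplyInnerSelf x)) → T ≤ 1 := by
    intro s T hT hTm
    refine hT.le_of_reApplyInnerSelf_le hone fun x ↦ ?_
    rw [ContinuousLinearMap.reApplyInnerSelf_one,
      ← ENNReal.ofReal_le_ofReal_iff (by positivity), ← hTm, ← huniv]
    exact measure_mono (subset_univ s)
  induction s, hs using MeasurableSpace.induction_on_inter hC hpi with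
  | empty => exact ⟨0, ContinuousLinearMap.isPositive_zero, by
      simp [ContinuousLinearMap.reApplyInnerSelf_apply]⟩
  | basic s hs => exact h s hs
  | compl s hs ih =>
    obtain ⟨T, hT, hTm⟩ := ih
    refine ⟨1 - T, (ContinuousLinearMap.le_def _ _).1 (hle s T hT hTm), fun x ↦ ?_⟩
    rw [measure_compl hs (measure_ne_top _ _), huniv, hTm,
      ContinuousLinearMap.reApplyInnerSelf_sub, ContinuousLinearMap.reApplyInnerSelf_one,
      ENNReal.ofReal_sub _ (hT.2 x)]
  | iUnion f hd hf ih =>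
    choose T hT hTm using ih
    let P : ℕ → H →L[ℂ] H := fun n ↦ ∑ i ∈ Finset.range n, T i
    have hP : ∀ n, (P n).IsPositive := fun n ↦
      ContinuousLinearMap.isPositive_sum _ fun i _ ↦ hT i
    have hPm : ∀ n x, ∑ i ∈ Finset.range n, m x (f i) =
        ENNReal.ofReal ((P n).reApplyInnerSelf x) := by
      intro n x
      rw [ContinuousLinearMap.reApplyInnerSelf_sum,
        ENNReal.ofReal_sum_of_nonneg fun i _ ↦ (hT i).2 x]
      exact Finset.sum_congr rfl fun i _ ↦ hTm i x
    have hP1 : ∀ n, P n ≤ 1 := by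
      intro n
      refine hle (⋃ i ∈ Finset.range n, f i) _ (hP n) fun x ↦ ?_
      rw [← hPm, measure_biUnion_finset (fun i _ j _ hij ↦ hd hij) fun i _ ↦ hf i]
    have hmono : Monotone P := monotone_nat_of_le_succ fun n ↦ by
      simp only [P, Finset.sum_range_succ]
      exact le_add_of_nonneg_right ((ContinuousLinearMap.nonneg_iff_isPositive _).2 (hT n))
    obtain ⟨S, hS, hlim⟩ := exists_tendsto_apply_of_monotone hP hmono hP1
    refine ⟨S, hS, fun x ↦ ?_⟩
    rw [measure_iUnion hd hf]
    refine tendsto_nhds_unique (ENNReal.tendsto_nat_tsum _) ?_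
    simp only [hPm]
    refine (ENNReal.continuous_ofReal.tendsto _).comp ?_
    exact (Complex.continuous_re.tendsto _).comp ((hlim x).inner tendsto_const_nhds)

namespace QuantumProbabilityMeasure

variable {Z H : Type*} [MeasurableSpace Z] [NormedAddCommGroup H] [InnerProductSpace ℂ H]

theorem hasSum_inner (E : QuantumProbabilityMeasure Z H) (s : ℕ → {s : Set Z // MeasurableSet s})
    (hs : ∀ i j, i ≠ j → Disjoint (s i : Set Z) (s j : Set Z)) (x y : H) :
    HasSum (fun i ↦ (inner ℂ y (E.toFun (s i) x) : ℂ))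
      (inner ℂ y (E.toFun ⟨⋃ i, (s i : Set Z), .iUnion fun i ↦ (s i).2⟩ x)) := by
  let _ := weakStarTopology H
  let φ : (H →L[ℂ] H) →+ ℂ :=
    { toFun A := inner ℂ y (A x)
      map_zero' := by simp
      map_add' A B := by simp }
  exact (E.hasSum_iUnion s hs).map φ (continuous_weakStarTopology_inner x y)

theorem ext_toFun {E F : QuantumProbabilityMeasure Z H} (h : ∀ s, E.toFun s = F.toFun s) :
    E = F := by
  cases E
  cases F
  congr
  exact funext h

variable [CompleteSpace H]

/-- The scalar measure `s ↦ ⟪x, E s T x⟫`, for a positive operator `T` commuting with `E`. -/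
theorem exists_measure_eq_mul (E : QuantumProbabilityMeasure Z H) {T : H →L[ℂ] H}
    (hT : T.IsPositive) (hc : ∀ s, Commute (E.toFun s) T) (x : H) :
    ∃ μ : Measure Z, IsFiniteMeasure μ ∧ ∀ s : {s : Set Z // MeasurableSet s},
      μ s = ENNReal.ofReal ((E.toFun s * T).reApplyInnerSelf x) := by
  have hp : ∀ s, (E.toFun s * T).IsPositive := fun s ↦ by
    rw [← ContinuousLinearMap.nonneg_iff_isPositive]
    exact Commute.mul_nonneg ((ContinuousLinearMap.nonneg_iff_isPositive _).2 (E.isPositive s))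
      ((ContinuousLinearMap.nonneg_iff_isPositive _).2 hT) (hc s)
  refine exists_measure_eq_ofReal (fun s ↦ (E.toFun s * T).reApplyInnerSelf x)
    (fun s ↦ (hp s).2 x) fun s hs ↦ ?_
  simp only [ContinuousLinearMap.reApplyInnerSelf_apply, (hp _).inner_left_eq_inner_right]
  exact Complex.hasSum_re (E.hasSum_inner s hs (T x) x)

theorem exists_measure_eq (E : QuantumProbabilityMeasure Z H) (x : H) :
    ∃ μ : Measure Z, IsFiniteMeasure μ ∧ ∀ s : {s : Set Z // MeasurableSet s},
      μ s = ENNReal.ofReal ((E.toFun s).reApplyInnerSelf x) := by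
  simpa using E.exists_measure_eq_mul ContinuousLinearMap.isPositive_one
    (fun s ↦ Commute.one_right _) x

/-- A family of finite measures given by quadratic forms of positive operators comes from a
quantum probability measure. -/
theorem exists_of_measure_eq (m : H → Measure Z)
    (huniv : ∀ x, m x univ = ENNReal.ofReal (‖x‖ ^ 2))
    (h : ∀ s, MeasurableSet s → ∃ T : H →L[ℂ] H, T.IsPositive ∧
      ∀ x, m x s = ENNReal.ofReal (T.reApplyInnerSelf x)) :
    ∃ G : QuantumProbabilityMeasure Z H, ∀ (s : {s : Set Z // MeasurableSet s}) (x : H),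
      m x s = ENNReal.ofReal ((G.toFun s).reApplyInnerSelf x) := by
  choose T hT hTm using fun s : {s : Set Z // MeasurableSet s} ↦ h s s.2
  have hone : (1 : H →L[ℂ] H).IsPositive := ContinuousLinearMap.isPositive_one
  have hu : T ⟨univ, .univ⟩ = 1 := by
    refine (hT _).ext_reApplyInnerSelf hone fun x ↦ ?_
    rw [ContinuousLinearMap.reApplyInnerSelf_one,
      ← ENNReal.ofReal_eq_ofReal_iff ((hT _).2 x) (by positivity), ← hTm, ← huniv]
  refine ⟨⟨T, hT, hu, fun s hs ↦ ?_⟩, hTm⟩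
  have hd : Pairwise (Function.onFun Disjoint fun i ↦ (s i : Set Z)) := fun i j hij ↦ hs i j hij
  refine hasSum_weakStarTopology_of_hasSum_inner (fun t ↦ ?_)
    (hasSum_inner_of_hasSum_reApplyInnerSelf (fun i ↦ hT _) (hT _) fun x ↦ ?_)
  · have hp : (∑ i ∈ t, T (s i)).IsPositive :=
      ContinuousLinearMap.isPositive_sum _ fun i _ ↦ hT _
    rw [CStarAlgebra.norm_le_one_iff_of_nonneg _
      ((ContinuousLinearMap.nonneg_iff_isPositive _).2 hp)]
    refine hp.le_of_reApplyInnerSelf_le hone fun x ↦ ?_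
    rw [ContinuousLinearMap.reApplyInnerSelf_one,
      ← ENNReal.ofReal_le_ofReal_iff (by positivity), ← huniv,
      ContinuousLinearMap.reApplyInnerSelf_sum, ENNReal.ofReal_sum_of_nonneg fun i _ ↦ (hT _).2 x]
    simp only [← hTm]
    rw [← measure_biUnion_finset (fun i _ j _ hij ↦ hd hij) fun i _ ↦ (s i).2]
    exact measure_mono (subset_univ _)
  · have h1 := hTm ⟨⋃ i, (s i : Set Z), .iUnion fun i ↦ (s i).2⟩ x
    rw [measure_iUnion hd fun i ↦ (s i).2] at h1
    simp only [hTm] at h1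
    have h2 := ENNReal.hasSum_toReal (h1.trans_ne ENNReal.ofReal_ne_top)
    rw [← ENNReal.tsum_toReal_eq fun _ ↦ ENNReal.ofReal_ne_top, h1] at h2
    simpa only [ENNReal.toReal_ofReal ((hT _).2 x)] using h2

/-! ### Uniqueness and existence of the product -/

variable {X Y : Type*} [MeasurableSpace X] [MeasurableSpace Y]

theorem isPositive_mul_of_commutingRanges {E : QuantumProbabilityMeasure X H}
    {F : QuantumProbabilityMeasure Y H} (hEF : E.CommutingRanges F)
    (s : {s : Set X // MeasurableSet s}) (t : {t : Set Y // MeasurableSet t}) :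
    (E.toFun s * F.toFun t).IsPositive := by
  rw [← ContinuousLinearMap.nonneg_iff_isPositive]
  exact Commute.mul_nonneg ((ContinuousLinearMap.nonneg_iff_isPositive _).2 (E.isPositive s))
    ((ContinuousLinearMap.nonneg_iff_isPositive _).2 (F.isPositive t)) (hEF s t)

/-- A quantum probability measure on a product space is determined by its values on measurable
rectangles. -/
theorem IsProduct.unique {E : QuantumProbabilityMeasure X H} {F : QuantumProbabilityMeasure Y H}
    {G G' : QuantumProbabilityMeasure (X × Y) H} (hG : E.IsProduct F G) (hG' : E.IsProduct F G') :
    G = G' := by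
  refine ext_toFun fun s ↦ (G.isPositive s).ext_reApplyInnerSelf (G'.isPositive s) fun x ↦ ?_
  obtain ⟨μ, _, hμ⟩ := G.exists_measure_eq x
  obtain ⟨ν, _, hν⟩ := G'.exists_measure_eq x
  have : μ = ν := Measure.ext_prod fun {A} {B} hA hB ↦ by
    have h1 := hμ ⟨A ×ˢ B, hA.prod hB⟩
    have h2 := hν ⟨A ×ˢ B, hA.prod hB⟩
    rw [hG ⟨A, hA⟩ ⟨B, hB⟩] at h1
    rw [hG' ⟨A, hA⟩ ⟨B, hB⟩] at h2
    exact h1.trans h2.symm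
  rw [← ENNReal.ofReal_eq_ofReal_iff ((G.isPositive s).2 x) ((G'.isPositive s).2 x), ← hμ, ← hν,
    this]

/-- The product of quantum probability measures with commuting ranges exists. -/
theorem exists_isProduct
    {X : Type*} [TopologicalSpace X] [CompactSpace X] [T2Space X] [SecondCountableTopology X]
    [MeasurableSpace X] [BorelSpace X]
    {Y : Type*} [TopologicalSpace Y] [CompactSpace Y] [T2Space Y] [SecondCountableTopology Y]
    [MeasurableSpace Y] [BorelSpace Y]
    (E : QuantumProbabilityMeasure X H) (F : QuantumProbabilityMeasure Y H)
    (hEF : E.CommutingRanges F) : ∃ G, E.IsProduct F G := by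
  have hm : ∀ x : H, ∃ m : Measure (X × Y), ∀ A B (hA : MeasurableSet A) (hB : MeasurableSet B),
      m (A ×ˢ B) =
        ENNReal.ofReal ((E.toFun ⟨A, hA⟩ * F.toFun ⟨B, hB⟩).reApplyInnerSelf x) := by
    intro x
    have h1 : ∀ B, ∃ μ : Measure X, IsFiniteMeasure μ ∧
        ∀ (hB : MeasurableSet B) (s : {s : Set X // MeasurableSet s}),
          μ s = ENNReal.ofReal ((E.toFun s * F.toFun ⟨B, hB⟩).reApplyInnerSelf x) := by
      intro B
      by_cases hB : MeasurableSet B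
      · obtain ⟨μ, hμf, hμ⟩ :=
          E.exists_measure_eq_mul (F.isPositive ⟨B, hB⟩) (fun s ↦ hEF s _) x
        exact ⟨μ, hμf, fun _ ↦ hμ⟩
      -- The zero measure is a default that lets `μ` be defined on every subset of `Y`.
      · exact ⟨0, inferInstance, fun h ↦ absurd h hB⟩
    have h2 : ∀ A, ∃ ν : Measure Y, IsFiniteMeasure ν ∧
        ∀ (hA : MeasurableSet A) (t : {t : Set Y // MeasurableSet t}),
          ν t = ENNReal.ofReal ((E.toFun ⟨A, hA⟩ * F.toFun t).reApplyInnerSelf x) := by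
      intro A
      by_cases hA : MeasurableSet A
      · obtain ⟨ν, hνf, hν⟩ :=
          F.exists_measure_eq_mul (E.isPositive ⟨A, hA⟩) (fun t ↦ (hEF _ t).symm) x
        exact ⟨ν, hνf, fun _ t ↦ by rw [hν, (hEF _ t).eq]⟩
      · exact ⟨0, inferInstance, fun h ↦ absurd h hA⟩
    choose μ hμf hμ using h1
    choose ν hνf hν using h2
    obtain ⟨m, hm⟩ := exists_measure_prod_eq_bimeasure μ ν fun A B hA hB ↦ by
      rw [hμ B hB ⟨A, hA⟩, hν A hA ⟨B, hB⟩]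
    exact ⟨m, fun A B hA hB ↦ by rw [hm A B hA hB, hμ B hB ⟨A, hA⟩]⟩
  choose m hm using hm
  have huniv : ∀ x, m x univ = ENNReal.ofReal (‖x‖ ^ 2) := fun x ↦ by
    rw [← univ_prod_univ, hm x _ _ .univ .univ, E.map_univ, F.map_univ, mul_one,
      ContinuousLinearMap.reApplyInnerSelf_one]
  have hfin : ∀ x, IsFiniteMeasure (m x) := fun x ↦ ⟨by
    rw [huniv]; exact ENNReal.ofReal_lt_top⟩
  obtain ⟨G, hG⟩ := exists_of_measure_eq m huniv
    (exists_isPositive_of_measure_eq generateFrom_prod.symm isPiSystem_prod m huniv (by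
      rintro _ ⟨A, hA, B, hB, rfl⟩
      exact ⟨_, isPositive_mul_of_commutingRanges hEF ⟨A, hA⟩ ⟨B, hB⟩, fun x ↦ hm x A B hA hB⟩))
  refine ⟨G, fun A B ↦ (G.isPositive _).ext_reApplyInnerSelf
    (isPositive_mul_of_commutingRanges hEF A B) fun x ↦ ?_⟩
  rw [← ENNReal.ofReal_eq_ofReal_iff ((G.isPositive _).2 x)
    ((isPositive_mul_of_commutingRanges hEF A B).2 x), ← hG, ← hm x _ _ A.2 B.2]

/-! ### Spectral measures -/

theorem toFun_compl (G : QuantumProbabilityMeasure Z H) {s : Set Z} (hs : MeasurableSet s) :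
    G.toFun ⟨sᶜ, hs.compl⟩ = 1 - G.toFun ⟨s, hs⟩ := by
  rw [eq_sub_iff_add_eq]
  refine ((G.isPositive _).add (G.isPositive _)).ext_reApplyInnerSelf
    ContinuousLinearMap.isPositive_one fun x ↦ ?_
  obtain ⟨μ, _, hμ⟩ := G.exists_measure_eq x
  have h := measure_add_measure_compl (μ := μ) hs
  rw [hμ ⟨s, hs⟩, hμ ⟨sᶜ, hs.compl⟩, hμ ⟨univ, .univ⟩, G.map_univ,
    ← ENNReal.ofReal_add ((G.isPositive _).2 x) ((G.isPositive _).2 x),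
    ENNReal.ofReal_eq_ofReal_iff (add_nonneg ((G.isPositive _).2 x) ((G.isPositive _).2 x))
      (ContinuousLinearMap.isPositive_one.2 x)] at h
  rw [ContinuousLinearMap.reApplyInnerSelf_add, add_comm, h]

/-- Projections in the range of a quantum probability measure are orthogonal when they belong to
disjoint sets. -/
theorem mul_eq_zero_of_disjoint (G : QuantumProbabilityMeasure Z H)
    (s t : {s : Set Z // MeasurableSet s}) (hst : Disjoint (s : Set Z) t)
    (hs : IsIdempotentElem (G.toFun s)) (ht : IsIdempotentElem (G.toFun t)) :
    G.toFun t * G.toFun s = 0 := by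
  ext x
  -- With `v = G.toFun s x`, additivity gives `‖v‖ ^ 2 + ‖G.toFun t v‖ ^ 2 ≤ ‖v‖ ^ 2`.
  obtain ⟨μ, _, hμ⟩ := G.exists_measure_eq (G.toFun s x)
  have h := (measure_union hst t.2).symm.trans_le (measure_mono (subset_univ _) : _ ≤ μ univ)
  have key : ∀ r, IsIdempotentElem (G.toFun r) → ∀ v,
      (G.toFun r).reApplyInnerSelf v = ‖G.toFun r v‖ ^ 2 := by
    intro r hr v
    rw [← inner_self_eq_norm_sq (𝕜 := ℂ), ← (G.isPositive r).inner_left_eq_inner_right,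
      ContinuousLinearMap.reApplyInnerSelf_apply]
    congr 2
    exact congrArg (· v) hr.eq.symm
  have hss : G.toFun s (G.toFun s x) = G.toFun s x := congrArg (· x) hs.eq
  rw [hμ s, hμ t, hμ ⟨univ, .univ⟩, G.map_univ, key s hs, key t ht, hss,
    ContinuousLinearMap.reApplyInnerSelf_one, ← ENNReal.ofReal_add (by positivity) (by positivity),
    ENNReal.ofReal_le_ofReal_iff (by positivity)] at h
  have h0 : ‖G.toFun t (G.toFun s x)‖ ^ 2 = 0 := le_antisymm (by linarith) (by positivity)
  simpa using h0

/-- A quantum probability measure whose values on a generating π-system are idempotent is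
spectral. -/
theorem isSpectral_of_isIdempotentElem {C : Set (Set Z)}
    (hC : ‹MeasurableSpace Z› = MeasurableSpace.generateFrom C) (hpi : IsPiSystem C)
    (G : QuantumProbabilityMeasure Z H)
    (h : ∀ s, s ∈ C → ∀ hs : MeasurableSet s, IsIdempotentElem (G.toFun ⟨s, hs⟩)) :
    G.IsSpectral := by
  suffices ∀ s (hs : MeasurableSet s), IsIdempotentElem (G.toFun ⟨s, hs⟩) from
    fun s ↦ ⟨this s s.2, (G.isPositive s).isSelfAdjoint⟩
  intro s hs
  induction s, hs using MeasurableSpace.induction_on_inter hC hpi with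
  | empty =>
    have h0 := G.toFun_compl .univ
    simp only [compl_univ, G.map_univ, sub_self] at h0
    rw [h0]
    exact .zero
  | basic s hs => exact h s hs _
  | compl s hs ih =>
    rw [G.toFun_compl hs]
    exact ih.one_sub
  | iUnion f hd hf ih =>
    set P := G.toFun ⟨⋃ i, f i, .iUnion hf⟩
    have hsum := G.hasSum_inner (fun i ↦ ⟨f i, hf i⟩) fun i j hij ↦ hd hij
    -- Expanding `P` weakly, orthogonality leaves only the `i`-th term. Summing these identities
    -- over `i` then gives `P * P = P`.
    have habs : ∀ i, G.toFun ⟨f i, hf i⟩ * P = G.toFun ⟨f i, hf i⟩ := by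
      intro i
      ext y
      refine ext_inner_left ℂ fun z ↦ ?_
      change inner ℂ z (G.toFun ⟨f i, hf i⟩ (P y)) = _
      rw [← (G.isPositive _).inner_left_eq_inner_right]
      refine (hsum y _).unique ?_
      convert hasSum_single i fun j hj ↦ ?_ using 1
      · rw [(G.isPositive _).inner_left_eq_inner_right]
        exact congrArg (fun A : H →L[ℂ] H ↦ (inner ℂ z (A y) : ℂ)) (ih i).eq.symm
      · rw [(G.isPositive _).inner_left_eq_inner_right]
        have := G.mul_eq_zero_of_disjoint ⟨f j, hf j⟩ ⟨f i, hf i⟩ (hd hj) (ih j) (ih i)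
        have := congrArg (fun A : H →L[ℂ] H ↦ (inner ℂ z (A y) : ℂ)) this
        simpa using this
    ext y
    refine ext_inner_left ℂ fun z ↦ ?_
    change inner ℂ z (P (P y)) = _
    refine (hsum (P y) z).unique ?_
    convert hsum y z using 2 with i
    exact congrArg (fun A : H →L[ℂ] H ↦ (inner ℂ z (A y) : ℂ)) (habs i)

theorem IsProduct.isSpectral {E : QuantumProbabilityMeasure X H}
    {F : QuantumProbabilityMeasure Y H} (hEF : E.CommutingRanges F) (hE : E.IsSpectral)
    (hF : F.IsSpectral) {G : QuantumProbabilityMeasure (X × Y) H} (hG : E.IsProduct F G) :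
    G.IsSpectral := by
  refine G.isSpectral_of_isIdempotentElem generateFrom_prod.symm isPiSystem_prod ?_
  rintro _ ⟨A, hA, B, hB, rfl⟩ _
  have := hG ⟨A, hA⟩ ⟨B, hB⟩
  simp only at this
  rw [this]
  exact (hE _).isIdempotentElem.mul_of_commute (hEF _ _) (hF _).isIdempotentElem

end QuantumProbabilityMeasure

end

theorem theorem3p3
    {X : Type*} [TopologicalSpace X] [CompactSpace X] [T2Space X] [SecondCountableTopology X]
    [MeasurableSpace X] [BorelSpace X]
    {Y : Type*} [TopologicalSpace Y] [CompactSpace Y] [T2Space Y] [SecondCountableTopology Y]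
    [MeasurableSpace Y] [BorelSpace Y]
    {H : Type*} [NormedAddCommGroup H] [InnerProductSpace ℂ H] [CompleteSpace H]
    (E : QuantumProbabilityMeasure X H) (F : QuantumProbabilityMeasure Y H)
    (hEF : E.CommutingRanges F) :
    (∃! G : QuantumProbabilityMeasure (X × Y) H, E.IsProduct F G) ∧
      (E.IsSpectral → F.IsSpectral →
        ∀ G : QuantumProbabilityMeasure (X × Y) H, E.IsProduct F G → G.IsSpectral) := by
  obtain ⟨G, hG⟩ := QuantumProbabilityMeasure.exists_isProduct E F hEF
  exact ⟨⟨G, hG, fun G' hG' ↦ hG'.unique hG⟩, fun hE hF _ hG' ↦ hG'.isSpectral hEF hE hF⟩
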